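/- **Definitions.** An *event-state structure* is a triple $(\mathcal E,\mathbb S,\mathbb P)$ of a set $\mathcal E$ of events, a set $\mathbb S$ of states and a function $\mathbb P:\mathcal E\times\mathbb S\to[0,1]$ such that, with $\mathbb S_1(E)=\{\rho:\mathbb P(E,\rho)=1\}$ and $\mathbb S_0(E)=\{\rho:\mathbb P(E,\rho)=0\}$: 1. if $\mathbb S_1(E_1)=\mathbb S_1(E_2)$ then $E_1=E_2$; 2. there is an event $\mathbf 1$ with $\mathbb S_1(\mathbf 1)=\mathbb S$; 3. if $\mathbb S_1(E_1)\subseteq\mathbb S_1(E_2)$ then $\mathbb S_0(E_2)\subseteq\mathbb S_0(E_1)$; 4. for each $E$ there is an event $E'$ (necessarily unique) with $\mathbb S_1(E)=\mathbb S_0(E')$ and $\mathbb S_0(E)=\mathbb S_1(E')$; 5. if $E_1,E_2,\dots$ is a sequence of events with $\mathbb S_1(E_i)\subseteq\mathbb S_0(E_j)$ for $i\ne j$, there is an event $E$ such that $\mathbb S_1(E_i)\subseteq\mathbb S_1(E)$ for all $i$, such that $\mathbb S_1(E)\subseteq\mathbb S_1(F)$ whenever $\mathbb S_1(E_i)\subseteq\mathbb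 S_1(F)$ for all $i$, and such that $\sum_i\mathbb P(E_i,\rho)=\mathbb P(E,\rho)$ for all $\rho\in\mathbb S$; 6. if $\mathbb P(E,\rho_1)=\mathbb P(E,\rho_2)$ for all $E$ then $\rho_1=\rho_2$; 7. if $\rho_1,\rho_2,\ldots\in\mathbb S$, $t_i\in[0,1]$ and $\sum_i t_i=1$, there is $\rho\in\mathbb S$ with $\mathbb P(E,\rho)=\sum_i t_i\mathbb P(E,\rho_i)$ for all $E$. Events are partially ordered by $E_1\le E_2\iff\mathbb S_1(E_1)\subseteq\mathbb S_1(E_2)$; $\wedge$ and $\vee$ denote greatest lower and least upper bounds for this order, where they exist; $E_1\perp E_2$ means $E_1\le E_2'$. Two events are *compatible*, $E_1\,\mathcal C\,E_2$, if there are events $F_1,F_2,F_3$, pairwise orthogonal, with $E_1=F_1\vee F_3$ and $E_2=F_2\vee F_3$. Let $\mathbb O$ be the set of all maps $T:\mathbb D_T\to\mathbb S$ with $\mathbb D_T\subseteq\mathbb S$. Two such maps are equal iff they have the same domain and the same values there, and $T_1\circ T_2$ has domain $\{\rho\in\mathbb D_{T_2}:T_2(\rho)\in\mathbb D_{T_1}\}$.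 An *event-state-operation structure* $(\mathcal E,\mathbb S,\mathbb P,\mathbb T)$ is an event-state structure with a map $\mathbb T:\mathcal E\to\mathbb O$, $E\mapsto T_E$, such that: 1. the domain of $T_E$ is $\{\rho:\mathbb P(E,\rho)\ne0\}$; 2. if $\mathbb P(E,\rho)=1$ then $T_E(\rho)=\rho$; 3. if $\mathbb P(E,\rho)\neq0$ then $\mathbb P(E,T_E(\rho))=1$; 4. if $T_{E_1}\circ\cdots\circ T_{E_n}=T_{F_1}\circ\cdots\circ T_{F_n}$ then $T_{E_n}\circ\cdots\circ T_{E_1}=T_{F_n}\circ\cdots\circ T_{F_1}$; 5. for every composition $T=T_{E_1}\circ\cdots\circ T_{E_n}$ ($n\ge1$) there is an event $E_T$ with $\mathbb S_1(E_T)=\mathbb S\setminus\mathbb D_T$; 6. if $E_2\le E_1$ and $\mathbb P(E_1,\rho)\ne0$ then $\mathbb P(E_2,T_{E_1}(\rho))=\mathbb P(E_2,\rho)/\mathbb P(E_1,\rho)$; 7. if $E_1\,\mathcal C\,E_2$ and $\mathbb P(E_1,\rho)\ne0$ then $\mathbb P(E_2,T_{E_1}(\rho))=\mathbb P(E_1\wedge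 E_2,T_{E_1}(\rho))$. (For compatible events the conjunction $E_1\wedge E_2$ always exists.) **Theorem.** Let $(\mathcal E,\mathbb S,\mathbb P,\mathbb T)$ be an event-state-operation structure and let $E_1,E_2\in\mathcal E$. Then $E_1\,\mathcal C\,E_2$ if and only if $T_{E_1}\circ T_{E_2}=T_{E_2}\circ T_{E_1}$. If $E_1\,\mathcal C\,E_2$, then $E_1\wedge E_2$ exists and $T_{E_1\wedge E_2}=T_{E_1}\circ T_{E_2}$. -/

import Mathlib

universe u v

set_option linter.checkUnivs false

/-- An event-state structure `(𝓔, 𝕊, ℙ)`. The sets `𝕊₁(E)` and `𝕊₀(E)` are written out as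
`{ρ | prob E ρ = 1}` and `{ρ | prob E ρ = 0}`. -/
structure EventStateStructure where
  /-- the logic: the set `𝓔` of events -/
  Event : Type u
  /-- the set `𝕊` of states -/
  State : Type v
  /-- the probability function -/
  prob : Event → State → ℝ
  prob_mem : ∀ E ρ, prob E ρ ∈ Set.Icc (0 : ℝ) 1
  /-- an event is determined by the states in which it is certain -/
  event_ext : ∀ E₁ E₂, {ρ | prob E₁ ρ = 1} = {ρ | prob E₂ ρ = 1} → E₁ = E₂
  /-- there is a certain event -/
  exists_certain : ∃ E, {ρ | prob E ρ = 1} = Set.univ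
  /-- implication reverses the order of the sets `𝕊₀` -/
  impossible_antitone : ∀ E₁ E₂, {ρ | prob E₁ ρ = 1} ⊆ {ρ | prob E₂ ρ = 1} →
    {ρ | prob E₂ ρ = 0} ⊆ {ρ | prob E₁ ρ = 0}
  /-- existence of complements -/
  exists_compl : ∀ E, ∃ E', {ρ | prob E ρ = 1} = {ρ | prob E' ρ = 0} ∧
    {ρ | prob E ρ = 0} = {ρ | prob E' ρ = 1}
  /-- countable orthogonal joins exist and the probabilities add up -/
  exists_sum : ∀ E : ℕ → Event,
    (∀ i j, i ≠ j → {ρ | prob (E i) ρ = 1} ⊆ {ρ | prob (E j) ρ = 0}) →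
    ∃ F, (∀ i, {ρ | prob (E i) ρ = 1} ⊆ {ρ | prob F ρ = 1}) ∧
      (∀ G, (∀ i, {ρ | prob (E i) ρ = 1} ⊆ {ρ | prob G ρ = 1}) →
        {ρ | prob F ρ = 1} ⊆ {ρ | prob G ρ = 1}) ∧
      ∀ ρ, HasSum (fun i => prob (E i) ρ) (prob F ρ)
  /-- a state is determined by the probabilities of the events -/
  state_ext : ∀ ρ₁ ρ₂, (∀ E, prob E ρ₁ = prob E ρ₂) → ρ₁ = ρ₂
  /-- countable mixtures of states exist -/
  exists_mixture : ∀ (ρ : ℕ → State) (t : ℕ → ℝ), (∀ i, t i ∈ Set.Icc (0 : ℝ) 1) →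
    HasSum t 1 → ∃ σ, ∀ E, HasSum (fun i => t i * prob E (ρ i)) (prob E σ)

namespace EventStateStructure

variable (X : EventStateStructure.{u, v})

/-- `𝕊₁(E)`: the states in which `E` occurs with certainty. -/
def S₁ (E : X.Event) : Set X.State := {ρ | X.prob E ρ = 1}

/-- `𝕊₀(E)`: the states in which `E` does not occur with certainty. -/
def S₀ (E : X.Event) : Set X.State := {ρ | X.prob E ρ = 0}

/-- The relation of implication: `E₁ ≤ E₂` iff `𝕊₁(E₁) ⊆ 𝕊₁(E₂)`. -/
instance : PartialOrder X.Event where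
  le E₁ E₂ := X.S₁ E₁ ⊆ X.S₁ E₂
  le_refl _ := Set.Subset.rfl
  le_trans _ _ _ h₁ h₂ := Set.Subset.trans h₁ h₂
  le_antisymm E₁ E₂ h₁ h₂ := X.event_ext E₁ E₂ (Set.Subset.antisymm h₁ h₂)

theorem le_iff (E₁ E₂ : X.Event) : E₁ ≤ E₂ ↔ X.S₁ E₁ ⊆ X.S₁ E₂ := Iff.rfl

theorem existsUnique_compl (E : X.Event) :
    ∃! E', X.S₁ E = X.S₀ E' ∧ X.S₀ E = X.S₁ E' := by
  obtain ⟨E', h₁, h₀⟩ := X.exists_compl E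
  exact ⟨E', ⟨h₁, h₀⟩, fun F hF => X.event_ext F E' (hF.2.symm.trans h₀)⟩

/-- The complement `E'` of the event `E`. -/
noncomputable instance : Compl X.Event where
  compl E := (X.existsUnique_compl E).choose

theorem compl_spec (E : X.Event) : X.S₁ E = X.S₀ Eᶜ ∧ X.S₀ E = X.S₁ Eᶜ :=
  (X.existsUnique_compl E).choose_spec.1

/-- Orthogonality of events: `E₁ ⊥ E₂` iff `E₁ ≤ E₂'`. -/
def Orth (E₁ E₂ : X.Event) : Prop := E₁ ≤ E₂ᶜ

/-- The relation of compatibility `E₁ 𝓒 E₂`. -/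
def Compatible (E₁ E₂ : X.Event) : Prop :=
  ∃ F₁ F₂ F₃ : X.Event, X.Orth F₁ F₂ ∧
    (X.Orth F₁ F₃ ∧ IsLUB {F₁, F₃} E₁) ∧ (X.Orth F₂ F₃ ∧ IsLUB {F₂, F₃} E₂)

end EventStateStructure

/-- The composition `T_{E₁} ∘ T_{E₂} ∘ ⋯ ∘ T_{Eₙ}` of partial maps along the list
`[E₁, …, Eₙ]`. The composition `PFun.comp f g` has domain `{ρ ∈ Dom g | g ρ ∈ Dom f}`. -/
def compList {α : Type u} {β : Type v} (T : α → (β →. β)) : List α → (β →. β)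
  | [] => PFun.id β
  | E :: l => (T E).comp (compList T l)

/-- A map `𝕋 : E ↦ T_E` making `X = (𝓔, 𝕊, ℙ)` an event-state-operation structure
`(𝓔, 𝕊, ℙ, 𝕋)`. The operation `op E = T_E` is a map from a
subset of the states to the states, and `σ ∈ op E ρ` says that `ρ` is in the domain of `T_E` and
`T_E(ρ) = σ`. -/
structure EventStateStructure.Operations (X : EventStateStructure.{u, v}) where
  op : X.Event → (X.State →. X.State)
  /-- `T_E` is defined exactly at the states in which `E` has nonzero probability -/
  op_dom : ∀ E, (op E).Dom = {ρ | X.prob E ρ ≠ 0}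
  /-- a state in which `E` is certain is fixed by `T_E` -/
  op_of_prob_eq_one : ∀ E ρ, X.prob E ρ = 1 → ρ ∈ op E ρ
  /-- `E` is certain in the state `T_E(ρ)` -/
  prob_op_self : ∀ E ρ, ∀ σ ∈ op E ρ, X.prob E σ = 1
  /-- if two compositions of operations agree, so do the reversed compositions -/
  op_reverse : ∀ l m : List X.Event, l ≠ [] → l.length = m.length →
    compList op l = compList op m →
    compList op l.reverse = compList op m.reverse
  /-- the states outside the domain of a composition of operations are those in which some
  event is certain -/
  exists_event_not_dom : ∀ l : List X.Event, l ≠ [] →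
    ∃ E, {ρ | X.prob E ρ = 1} = {ρ | ρ ∉ (compList op l).Dom}
  /-- conditioning of an event below `E₁` -/
  prob_op_of_le : ∀ E₁ E₂ : X.Event, E₂ ≤ E₁ →
    ∀ ρ, ∀ σ ∈ op E₁ ρ, X.prob E₂ σ = X.prob E₂ ρ / X.prob E₁ ρ
  /-- conditioning of a compatible event; `M` is the conjunction `E₁ ∧ E₂` -/
  prob_op_of_compatible : ∀ E₁ E₂ M : X.Event,
    X.Compatible E₁ E₂ → IsGLB {E₁, E₂} M →
    ∀ ρ, ∀ σ ∈ op E₁ ρ, X.prob E₂ σ = X.prob M σ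

/-!
Two facts about the compositions `T = T_{E₁} ∘ ⋯ ∘ T_{Eₙ}` carry the proof. Write `T*` for the
reversed composition `T_{Eₙ} ∘ ⋯ ∘ T_{E₁}`, which by axiom depends only on `T` and `n`.

* If `T` is undefined at every state in which `M'` is certain, then `T ∘ T_{M'}` is the empty map,
  hence so is its reversal `T_{M'} ∘ T*`, and every value of `T*` makes `M` certain
  (`Operations.prob_eq_one_of_mem_comp`).
* If moreover `T = T_{E₂} ∘ T_{E₁}`, `M ≤ E₁` and `M ≤ E₂`, then
  `T_M ∘ T_{E₁} ∘ T_{E₂} = T_{E₁} ∘ T_{E₂}`. Reversing,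
  `T_{E₂} ∘ T_{E₁} = T_{E₂} ∘ T_{E₁} ∘ T_M = T_M` (`Operations.comp_eq_op`).

If `E₁ = F₁ ∨ F₃` and `E₂ = F₂ ∨ F₃` with `F₁, F₂, F₃` pairwise orthogonal, additivity of
probabilities shows that `F₃ = E₁ ∧ E₂`, and the two conditioning axioms show that both
`T_{E₁} ∘ T_{E₂}` and `T_{E₂} ∘ T_{E₁}` have the same domain as `T_{F₃}`. By the second fact both
are equal to `T_{F₃}`.

Conversely, if `T = T_{E₁} ∘ T_{E₂} = T_{E₂} ∘ T_{E₁}`, let `M` be the complement of the event that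
is certain exactly off the domain of `T`. Then `M ≤ E₁` and `M ≤ E₂`, since `T` vanishes on `E₁'`
and on `E₂'`; so `T = T_M` by the second fact. With `F₁ = E₁ - M` and `F₂ = E₂ - M`, which exist by
orthomodularity (`exists_orthocomplement_of_le`), a state in which `F₁` is certain is fixed by
`T_{E₁}` and lies outside the domain of `T_M = T_{E₂} ∘ T_{E₁}`. Hence `E₂` is impossible in it,
so `F₁ ⊥ F₂`, and `F₁, F₂, M` witness compatibility.
-/

namespace EventStateStructure

variable (X : EventStateStructure.{u, v})

/-! ### The orthomodular poset of events -/

theorem le_iff_prob {E F : X.Event} : E ≤ F ↔ ∀ ρ, X.prob E ρ = 1 → X.prob F ρ = 1 := Iff.rfl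

theorem prob_compl_eq_one_iff {E : X.Event} {ρ : X.State} :
    X.prob Eᶜ ρ = 1 ↔ X.prob E ρ = 0 :=
  (Set.ext_iff.1 (X.compl_spec E).2 ρ).symm

theorem prob_compl_eq_zero_iff {E : X.Event} {ρ : X.State} :
    X.prob Eᶜ ρ = 0 ↔ X.prob E ρ = 1 :=
  (Set.ext_iff.1 (X.compl_spec E).1 ρ).symm

theorem orth_iff_prob {E F : X.Event} :
    X.Orth E F ↔ ∀ ρ, X.prob E ρ = 1 → X.prob F ρ = 0 := by
  simp only [Orth, le_iff_prob, prob_compl_eq_one_iff]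

theorem prob_eq_zero_of_le {E F : X.Event} (h : E ≤ F) {ρ : X.State}
    (hF : X.prob F ρ = 0) : X.prob E ρ = 0 :=
  X.impossible_antitone E F h hF

theorem Orth.symm {E F : X.Event} (h : X.Orth E F) : X.Orth F E := by
  rw [orth_iff_prob]
  intro ρ hF
  exact X.prob_eq_zero_of_le h (X.prob_compl_eq_zero_iff.2 hF)

theorem exists_impossible : ∃ Z : X.Event, ∀ ρ, X.prob Z ρ = 0 := by
  obtain ⟨U, hU⟩ := X.exists_certain
  exact ⟨Uᶜ, fun ρ => X.prob_compl_eq_zero_iff.2 (Set.eq_univ_iff_forall.1 hU ρ)⟩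

theorem event_eq_of_prob_eq {E F : X.Event} (h : ∀ ρ, X.prob E ρ = X.prob F ρ) : E = F :=
  X.event_ext E F (by simp only [h])

/-- Joins of three orthogonal events: the axiom on sequences, applied to `A, B, C` followed by the
impossible event. -/
theorem exists_isLUB_triple {A B C : X.Event} (hAB : X.Orth A B) (hAC : X.Orth A C)
    (hBC : X.Orth B C) :
    ∃ G, IsLUB {A, B, C} G ∧ ∀ ρ, X.prob G ρ = X.prob A ρ + X.prob B ρ + X.prob C ρ := by
  obtain ⟨Z, hZ⟩ := X.exists_impossible
  let s : ℕ → X.Event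
    | 0 => A
    | 1 => B
    | 2 => C
    | _ + 3 => Z
  have hs : ∀ i j, i ≠ j → {ρ | X.prob (s i) ρ = 1} ⊆ {ρ | X.prob (s j) ρ = 0} := by
    intro i j hij ρ hi
    have key : ∀ {E F : X.Event}, X.Orth E F → X.prob E ρ = 1 → X.prob F ρ = 0 :=
      fun h => X.orth_iff_prob.1 h ρ
    match i, j with
    | 0, 0 | 1, 1 | 2, 2 => exact absurd rfl hij
    | 0, 1 => exact key hAB hi
    | 0, 2 => exact key hAC hi
    | 1, 2 => exact key hBC hi
    | 1, 0 => exact key hAB.symm hi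
    | 2, 0 => exact key hAC.symm hi
    | 2, 1 => exact key hBC.symm hi
    | _, j + 3 => exact hZ ρ
    | i + 3, _ => exact absurd (show X.prob Z ρ = 1 from hi) (by simp [hZ])
  obtain ⟨G, hub, hleast, hsum⟩ := X.exists_sum s hs
  refine ⟨G, ⟨?_, ?_⟩, fun ρ => ?_⟩
  · rintro E (rfl | rfl | rfl)
    exacts [hub 0, hub 1, hub 2]
  · intro H hH
    refine hleast H fun i => ?_
    match i with
    | 0 => exact hH (by simp : A ∈ _)
    | 1 => exact hH (by simp : B ∈ _)
    | 2 => exact hH (by simp : C ∈ _)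
    | i + 3 => exact fun ρ hρ => absurd (show X.prob Z ρ = 1 from hρ) (by simp [hZ])
  · refine (hsum ρ).unique ?_
    have h := hasSum_sum_of_ne_finset_zero (L := .unconditional ℕ) (f := fun i => X.prob (s i) ρ)
      (s := Finset.range 3) (fun i hi => by
        obtain ⟨k, rfl⟩ := Nat.exists_eq_add_of_le' (not_lt.1 (Finset.mem_range.not.1 hi))
        exact hZ ρ)
    simpa [Finset.sum_range_succ, s] using h

theorem exists_isLUB_pair {A B : X.Event} (h : X.Orth A B) :
    ∃ G, IsLUB {A, B} G ∧ ∀ ρ, X.prob G ρ = X.prob A ρ + X.prob B ρ := by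
  obtain ⟨Z, hZ⟩ := X.exists_impossible
  obtain ⟨G, ⟨hub, hleast⟩, hG⟩ := X.exists_isLUB_triple h
    (X.orth_iff_prob.2 fun ρ _ => hZ ρ) (X.orth_iff_prob.2 fun ρ _ => hZ ρ)
  refine ⟨G, ⟨fun E hE => hub ?_, fun H hH => hleast ?_⟩, fun ρ => by simp [hG, hZ]⟩
  · rcases hE with rfl | rfl <;> simp
  · rintro E (rfl | rfl | rfl)
    · exact hH (by simp)
    · exact hH (by simp)
    · exact fun ρ hρ => absurd (show X.prob E ρ = 1 from hρ) (by simp [hZ])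

theorem prob_eq_add_of_isLUB {A B E : X.Event} (h : X.Orth A B) (hE : IsLUB {A, B} E)
    (ρ : X.State) : X.prob E ρ = X.prob A ρ + X.prob B ρ := by
  obtain ⟨G, hG, hprob⟩ := X.exists_isLUB_pair h
  rw [hE.unique hG, hprob]

theorem prob_compl (E : X.Event) (ρ : X.State) : X.prob Eᶜ ρ = 1 - X.prob E ρ := by
  obtain ⟨Z, hZ⟩ := X.exists_impossible
  obtain ⟨G, hG, hprob⟩ := X.exists_isLUB_pair
    (X.orth_iff_prob.2 fun ρ h => X.prob_compl_eq_zero_iff.2 h : X.Orth E Eᶜ)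
  -- A state in which `G = E ∨ E'` is impossible would make `E'`, hence `G`, certain.
  have hGZ : Gᶜ = Z := by
    refine X.event_ext _ _ (Set.ext fun σ => ⟨fun hσ => ?_, fun hσ => ?_⟩)
    · have h0 : X.prob G σ = 0 := X.prob_compl_eq_one_iff.1 hσ
      have hE0 : X.prob E σ = 0 := X.prob_eq_zero_of_le (hG.1 (by simp)) h0
      have h1 : X.prob G σ = 1 :=
        X.le_iff_prob.1 (hG.1 (by simp : Eᶜ ∈ _)) σ (X.prob_compl_eq_one_iff.2 hE0)
      exact absurd (h0.symm.trans h1) zero_ne_one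
    · exact absurd (show X.prob Z σ = 1 from hσ) (by simp [hZ])
  have h1 : X.prob G ρ = 1 := X.prob_compl_eq_zero_iff.1 (hGZ ▸ hZ ρ)
  linarith [hprob ρ]

theorem compl_compl_event (E : X.Event) : Eᶜᶜ = E :=
  X.event_eq_of_prob_eq fun ρ => by simp [prob_compl]

/-- Orthomodularity: if `M ≤ E`, there is a relative complement `F = E ∧ M'` with
`E = F ∨ M`. -/
theorem exists_orthocomplement_of_le {M E : X.Event} (h : M ≤ E) :
    ∃ F, X.Orth F M ∧ IsLUB {F, M} E := by
  obtain ⟨G, -, hG⟩ := X.exists_isLUB_pair (A := M) (B := Eᶜ)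
    (by rwa [Orth, compl_compl_event])
  have hprob : ∀ ρ, X.prob Gᶜ ρ = X.prob E ρ - X.prob M ρ := fun ρ => by
    rw [prob_compl, hG, prob_compl]; ring
  have horth : X.Orth Gᶜ M := X.orth_iff_prob.2 fun ρ hρ => by
    have h1 := (X.prob_mem E ρ).2
    have h2 := (X.prob_mem M ρ).1
    linarith [hprob ρ]
  obtain ⟨H, hH, hHprob⟩ := X.exists_isLUB_pair horth
  obtain rfl : H = E := X.event_eq_of_prob_eq fun ρ => by rw [hHprob, hprob]; ring
  exact ⟨Gᶜ, horth, hH⟩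

/-- In a compatible decomposition the common part `F₃` is the conjunction of the two events. -/
theorem isGLB_of_orth {F₁ F₂ F₃ E₁ E₂ : X.Event} (h₁₂ : X.Orth F₁ F₂) (h₁₃ : X.Orth F₁ F₃)
    (hE₁ : IsLUB {F₁, F₃} E₁) (h₂₃ : X.Orth F₂ F₃) (hE₂ : IsLUB {F₂, F₃} E₂) :
    IsGLB {E₁, E₂} F₃ := by
  refine ⟨?_, fun G hG ρ hρ => ?_⟩
  · rintro E (rfl | rfl)
    exacts [hE₁.1 (by simp), hE₂.1 (by simp)]
  · obtain ⟨H, -, hH⟩ := X.exists_isLUB_triple h₁₂ h₁₃ h₂₃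
    have h1 : X.prob E₁ ρ = 1 := hG (by simp : E₁ ∈ _) hρ
    have h2 : X.prob E₂ ρ = 1 := hG (by simp : E₂ ∈ _) hρ
    rw [X.prob_eq_add_of_isLUB h₁₃ hE₁] at h1
    rw [X.prob_eq_add_of_isLUB h₂₃ hE₂] at h2
    have hF₁ := (X.prob_mem F₁ ρ).1
    have hF₃ := (X.prob_mem F₃ ρ).2
    have hH1 := (X.prob_mem H ρ).2
    rw [hH] at hH1
    change X.prob F₃ ρ = 1
    linarith

theorem Compatible.symm {E₁ E₂ : X.Event} (h : X.Compatible E₁ E₂) : X.Compatible E₂ E₁ := by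
  obtain ⟨F₁, F₂, F₃, h₁₂, h₁, h₂⟩ := h
  exact ⟨F₂, F₁, F₃, h₁₂.symm, h₂, h₁⟩

namespace Operations

variable {X} (T : X.Operations)

/-! ### Compositions of operations -/

theorem exists_mem_op_iff {E : X.Event} {ρ : X.State} :
    (∃ σ, σ ∈ T.op E ρ) ↔ X.prob E ρ ≠ 0 := by
  rw [← Part.dom_iff_mem]
  exact Set.ext_iff.1 (T.op_dom E) ρ

theorem eq_of_mem_op {E : X.Event} {ρ σ : X.State} (h : X.prob E ρ = 1)
    (hσ : σ ∈ T.op E ρ) : σ = ρ :=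
  Part.mem_unique hσ (T.op_of_prob_eq_one E ρ h)

theorem mem_comp_iff {α β γ : Type*} {f : β →. γ} {g : α →. β} {a : α} {c : γ} :
    c ∈ f.comp g a ↔ ∃ b ∈ g a, c ∈ f b :=
  Part.mem_bind_iff

theorem op_comp_eq_self {α : Type*} {M : X.Event} {f : α →. X.State}
    (h : ∀ a, ∀ σ ∈ f a, X.prob M σ = 1) : (T.op M).comp f = f := by
  refine PFun.ext fun a σ => ?_
  rw [mem_comp_iff]
  constructor
  · rintro ⟨τ, hτ, hσ⟩
    rwa [T.eq_of_mem_op (h a τ hτ) hσ]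
  · exact fun hσ => ⟨σ, hσ, T.op_of_prob_eq_one M σ (h a σ hσ)⟩

theorem op_comp_op_of_le {M E : X.Event} (h : M ≤ E) : (T.op E).comp (T.op M) = T.op M :=
  T.op_comp_eq_self fun ρ σ hσ => X.le_iff_prob.1 h σ (T.prob_op_self M ρ σ hσ)

theorem op_comp_op_self (E : X.Event) : (T.op E).comp (T.op E) = T.op E :=
  T.op_comp_op_of_le le_rfl

theorem compList_pair (A B : X.Event) :
    compList T.op [A, B] = (T.op A).comp (T.op B) := by
  simp [compList, PFun.comp_id]

theorem compList_triple (A B C : X.Event) :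
    compList T.op [A, B, C] = (T.op A).comp ((T.op B).comp (T.op C)) := by
  simp [compList, PFun.comp_id]

theorem comp_comp_reverse {A B C A' B' C' : X.Event}
    (h : (T.op A).comp ((T.op B).comp (T.op C)) = (T.op A').comp ((T.op B').comp (T.op C'))) :
    (T.op C).comp ((T.op B).comp (T.op A)) = (T.op C').comp ((T.op B').comp (T.op A')) := by
  have := T.op_reverse [A, B, C] [A', B', C'] (by simp) rfl
    (by rwa [compList_triple, compList_triple])
  simpa [compList_triple] using this

/-- If a composition of operations is nowhere defined, so is the reversed one. -/
theorem not_mem_comp_comp_reverse {A B C : X.Event}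
    (h : ∀ ρ σ, σ ∉ (T.op A).comp ((T.op B).comp (T.op C)) ρ) (ρ σ : X.State) :
    σ ∉ (T.op C).comp ((T.op B).comp (T.op A)) ρ := by
  obtain ⟨Z, hZ⟩ := X.exists_impossible
  -- The empty map is the composition `T_Z ∘ T_Z ∘ T_Z`, which is its own reversal.
  have hempty : ∀ ρ σ, σ ∉ (T.op Z).comp ((T.op Z).comp (T.op Z)) ρ := by
    intro ρ σ hσ
    rw [op_comp_op_self, op_comp_op_self] at hσ
    exact T.exists_mem_op_iff.1 ⟨σ, hσ⟩ (hZ ρ)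
  have := T.comp_comp_reverse (A' := Z) (B' := Z) (C' := Z)
    (PFun.ext fun ρ σ => iff_of_false (h ρ σ) (hempty ρ σ))
  rw [this]
  exact hempty ρ σ

/-- If `T_{E₂} ∘ T_{E₁}` is only defined where `M` is possible, then the values of the reversed
composition `T_{E₁} ∘ T_{E₂}` make `M` certain. -/
theorem prob_eq_one_of_mem_comp {M E₁ E₂ : X.Event}
    (h : ∀ ρ σ, σ ∈ (T.op E₂).comp (T.op E₁) ρ → X.prob M ρ ≠ 0) :
    ∀ ρ, ∀ σ ∈ (T.op E₁).comp (T.op E₂) ρ, X.prob M σ = 1 := by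
  intro ρ σ hσ
  have hempty : ∀ ρ σ, σ ∉ (T.op E₂).comp ((T.op E₁).comp (T.op Mᶜ)) ρ := by
    intro ρ σ hσ
    rw [← PFun.comp_assoc, mem_comp_iff] at hσ
    obtain ⟨τ, hτ, hσ⟩ := hσ
    exact h τ σ hσ (X.prob_compl_eq_one_iff.1 (T.prob_op_self _ _ _ hτ))
  by_contra hM
  obtain ⟨τ, hτ⟩ := T.exists_mem_op_iff.2 (mt X.prob_compl_eq_zero_iff.1 hM)
  exact T.not_mem_comp_comp_reverse hempty ρ τ (mem_comp_iff.2 ⟨σ, hσ, hτ⟩)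

/-- A composition `T_{E₂} ∘ T_{E₁}` that is only defined where a common lower bound `M` of `E₁`
and `E₂` is possible equals `T_M`. -/
theorem comp_eq_op {M E₁ E₂ : X.Event} (hM₁ : M ≤ E₁) (hM₂ : M ≤ E₂)
    (h : ∀ ρ σ, σ ∈ (T.op E₂).comp (T.op E₁) ρ → X.prob M ρ ≠ 0) :
    (T.op E₂).comp (T.op E₁) = T.op M := by
  have hM : (T.op M).comp ((T.op E₁).comp (T.op E₂)) =
      (T.op E₁).comp ((T.op E₁).comp (T.op E₂)) := by
    rw [T.op_comp_eq_self (T.prob_eq_one_of_mem_comp h), ← PFun.comp_assoc, op_comp_op_self]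
  have hrev := T.comp_comp_reverse hM
  rw [T.op_comp_op_of_le hM₁, T.op_comp_op_of_le hM₂, op_comp_op_self] at hrev
  exact hrev.symm

/-! ### Compatibility and commutation -/

/-- Conditioning on `E₁` turns `E₂` into `M`, and `M` into an event of probability
`prob M ρ / prob E₁ ρ`, so the composition is only defined where `M` is possible. -/
theorem comp_eq_op_of_compatible {M E₁ E₂ : X.Event} (h : X.Compatible E₁ E₂)
    (hM : IsGLB {E₁, E₂} M) : (T.op E₂).comp (T.op E₁) = T.op M := by
  have hM₁ : M ≤ E₁ := hM.1 (by simp)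
  refine T.comp_eq_op hM₁ (hM.1 (by simp)) fun ρ σ hσ hρ => ?_
  obtain ⟨τ, hτ, hσ⟩ := mem_comp_iff.1 hσ
  refine T.exists_mem_op_iff.1 ⟨σ, hσ⟩ ?_
  rw [T.prob_op_of_compatible E₁ E₂ M h hM ρ τ hτ, T.prob_op_of_le E₁ M hM₁ ρ τ hτ, hρ, zero_div]

theorem exists_isGLB_of_compatible {E₁ E₂ : X.Event} (h : X.Compatible E₁ E₂) :
    ∃ M, IsGLB {E₁, E₂} M ∧ T.op M = (T.op E₁).comp (T.op E₂) := by
  obtain ⟨F₁, F₂, F₃, h₁₂, ⟨h₁₃, hE₁⟩, h₂₃, hE₂⟩ := id h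
  have hF₃ := X.isGLB_of_orth h₁₂ h₁₃ hE₁ h₂₃ hE₂
  exact ⟨F₃, hF₃, (T.comp_eq_op_of_compatible h.symm (Set.pair_comm E₁ E₂ ▸ hF₃)).symm⟩

theorem comp_comm_of_compatible {E₁ E₂ : X.Event} (h : X.Compatible E₁ E₂) :
    (T.op E₁).comp (T.op E₂) = (T.op E₂).comp (T.op E₁) := by
  obtain ⟨M, hM, hop⟩ := T.exists_isGLB_of_compatible h
  rw [← hop, T.comp_eq_op_of_compatible h hM]

/-- The product of two commuting operations is the operation of a common lower bound of the
two events. -/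
theorem exists_op_eq_comp_of_comm {E₁ E₂ : X.Event}
    (h : (T.op E₁).comp (T.op E₂) = (T.op E₂).comp (T.op E₁)) :
    ∃ M, M ≤ E₁ ∧ M ≤ E₂ ∧ (T.op E₂).comp (T.op E₁) = T.op M := by
  obtain ⟨N, hN⟩ := T.exists_event_not_dom [E₂, E₁] (by simp)
  rw [compList_pair] at hN
  have hN' : ∀ ρ, X.prob N ρ = 1 ↔ ¬ ∃ σ, σ ∈ (T.op E₂).comp (T.op E₁) ρ := fun ρ => by
    rw [← Part.dom_iff_mem]
    exact Set.ext_iff.1 hN ρ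
  -- `Eᵢ' ≤ N`, since `Tᵢ`, and with it the product, is undefined where `Eᵢ'` is certain.
  have hle : ∀ A B : X.Event, (T.op E₂).comp (T.op E₁) = (T.op B).comp (T.op A) → Nᶜ ≤ A := by
    intro A B hAB
    rw [le_iff_prob]
    intro ρ hρ
    rw [prob_compl_eq_one_iff] at hρ
    rw [← prob_compl_eq_zero_iff]
    refine X.prob_eq_zero_of_le (X.le_iff_prob.2 fun τ hτ => (hN' τ).2 ?_) hρ
    rintro ⟨σ, hσ⟩
    rw [hAB, mem_comp_iff] at hσ
    obtain ⟨υ, hυ, -⟩ := hσ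
    exact T.exists_mem_op_iff.1 ⟨υ, hυ⟩ (X.prob_compl_eq_one_iff.1 hτ)
  refine ⟨Nᶜ, hle E₁ E₂ rfl, hle E₂ E₁ h.symm, T.comp_eq_op (hle E₁ E₂ rfl) (hle E₂ E₁ h.symm) ?_⟩
  intro ρ σ hσ hρ
  exact (hN' ρ).1 (X.prob_compl_eq_zero_iff.1 hρ) ⟨σ, hσ⟩

theorem compatible_of_comp_comm {E₁ E₂ : X.Event}
    (h : (T.op E₁).comp (T.op E₂) = (T.op E₂).comp (T.op E₁)) : X.Compatible E₁ E₂ := by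
  obtain ⟨M, hM₁, hM₂, hM⟩ := T.exists_op_eq_comp_of_comm h
  obtain ⟨F₁, hF₁, hE₁⟩ := X.exists_orthocomplement_of_le hM₁
  obtain ⟨F₂, hF₂, hE₂⟩ := X.exists_orthocomplement_of_le hM₂
  refine ⟨F₁, F₂, M, X.orth_iff_prob.2 fun ρ hρ => ?_, ⟨hF₁, hE₁⟩, hF₂, hE₂⟩
  have hρ₁ : X.prob E₁ ρ = 1 := X.le_iff_prob.1 (hE₁.1 (by simp)) ρ hρ
  have hρM : X.prob M ρ = 0 := X.orth_iff_prob.1 hF₁ ρ hρ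
  refine X.prob_eq_zero_of_le (hE₂.1 (by simp)) (?_ : X.prob E₂ ρ = 0)
  -- `T_{E₁}` fixes `ρ`, so if `E₂` were possible in `ρ`, then `T_{E₂} ∘ T_{E₁} = T_M` would be
  -- defined at `ρ`.
  by_contra hne
  obtain ⟨σ, hσ⟩ := T.exists_mem_op_iff.2 hne
  have hσM : σ ∈ T.op M ρ := hM ▸ mem_comp_iff.2 ⟨ρ, T.op_of_prob_eq_one E₁ ρ hρ₁, hσ⟩
  exact T.exists_mem_op_iff.1 ⟨σ, hσM⟩ hρM

end Operations

end EventStateStructure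

theorem mainTheorem2 (X : EventStateStructure.{u, v}) (T : X.Operations) (E₁ E₂ : X.Event) :
    (X.Compatible E₁ E₂ ↔ (T.op E₁).comp (T.op E₂) = (T.op E₂).comp (T.op E₁)) ∧
    (X.Compatible E₁ E₂ →
      ∃ M : X.Event, IsGLB {E₁, E₂} M ∧ T.op M = (T.op E₁).comp (T.op E₂)) :=
  ⟨⟨T.comp_comm_of_compatible, T.compatible_of_comp_comm⟩, T.exists_isGLB_of_compatible⟩
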